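/- Let $C\subset[0,1]$ be the middle-third Cantor set, and write $\overline 2:=-2$. Every $x\in[0,1]$ has a unique expansion $x=\sum_{n\ge1}u_n3^{-n}$ with $u_n\in\{0,2,\overline 2\}$ such that the first nonzero digit (if any) is not $\overline 2$ and $(u_n)$ ends neither with $2\,\overline 2^\infty$ nor with $\overline 2\,2^\infty$; call it the intrinsic ternary expansion of $x$. Let $\Phi=\{\phi_i\}_{i=1}^k$, $k\ge2$, with $\phi_i(x)=s_i3^{-m_i}x+d_i$, where $s_i\in\{1,-1\}$, $m_i\ge1$ is an integer, $0\le d_i\le1$, $s_1=1$, $d_1=0$, $d_i>0$ for at least one $i$, and $d_i>0$ whenever $s_i=-1$. Let $F_\Phi$ be its attractor, i.e. the unique non-empty compact set with $F_\Phi=\bigcup_{i=1}^k\phi_i(F_\Phi)$. Let $a\in C$, and let $a=\sum_{n\ge1}a_n3^{-n}$ (so $a_n\in\{0,2\}$) and $d_i=\sum_{n\ge1}u_{i,n}3^{-n}$ be the intrinsic ternary expansions. Write $U_\Phi(n)=(u_{1,n},\dots,u_{k,n})^T$ for $n\ge1$, and put $$\ell=\gcd(m_i: d_i=0),\quad r=\gcd(m_1,\dots,m_k),\quad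 D=\max_i m_i,$$ $$L=\Big(\min_i\frac{m_i}{r}-1\Big)\Big(\max_j\frac{m_j}{r}-1\Big),\quad n_0=\min\{n\ge1: U_\Phi(n)\ne0\}.$$ For a non-empty finite word $\mathbf x=x_1\cdots x_n$ over $\{1,\dots,k\}$, with length $|\mathbf x|=n$, let $V(\mathbf x)=(v_{j,p})_{1\le j\le n,\,p\ge1}$ be the matrix with $$v_{j,p}=s_{x_1}\cdots s_{x_{j-1}}\,u_{x_j,\;p-(m_{x_1}+\cdots+m_{x_{j-1}})}\ \text{ if } p>m_{x_1}+\cdots+m_{x_{j-1}},\qquad v_{j,p}=0\ \text{ otherwise.}$$ Say that the pair $(p,\mathbf x)$ is matching if, in the (possibly empty) finite sequence obtained by deleting all zeros from the $p$-th column of $V(\mathbf x)$: (i) neither two consecutive letters $2$ nor two consecutive letters $\overline 2$ appear; (ii) $a_p=0$ if the first letter is $2$, and $a_p=2$ if the first letter is $\overline 2$. **Theorem.** Assume $r=1$. Then $a+F_\Phi\subseteq C$ if and only if the following three properties hold: 1. $U_\Phi(n+\ell)=U_\Phi(n)$ for all $n\ge n_0+L+D$; 2. $a_{n+\ell}=a_n$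 for all $n\ge n_0+L$; 3. $(p,\mathbf x)$ is matching for every integer $p$ and every non-empty finite word $\mathbf x$ over $\{1,\dots,k\}$ such that $n_0\le p<n_0+L+D+2\ell D$ and $|\mathbf x|\le p-n_0+1$. -/

import Mathlib

open Set Topology

/-! ### Intrinsic ternary expansions -/

/-- Membership in the set `Θ` of admissible digit sequences over `{0, 2, -2}`.  Sequences are
indexed by `n ≥ 1`; the unused value at `0` is fixed to be `0`.  The first nonzero letter is not
`-2`, and the sequence ends neither with `2, -2, -2, …` nor with `-2, 2, 2, …`. -/
structure MemTheta (u : ℕ → ℤ) : Prop where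
  zero : u 0 = 0
  digit : ∀ n, u n = 0 ∨ u n = 2 ∨ u n = -2
  first_ne : ∀ n, (∀ j < n, u j = 0) → u n ≠ -2
  not_end_pos : ¬ ∃ n, u n = 2 ∧ ∀ j > n, u j = -2
  not_end_neg : ¬ ∃ n, u n = -2 ∧ ∀ j > n, u j = 2

/-- `u` is an intrinsic ternary expansion of `x`: `x = ∑_{n ≥ 1} u n / 3 ^ n` with `u ∈ Θ`. -/
def IsIntrinsicExpansion (u : ℕ → ℤ) (x : ℝ) : Prop :=
  MemTheta u ∧ HasSum (fun n : ℕ => (u n : ℝ) / 3 ^ n) x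

section Expansion

theorem hasSum_iff_of_eq {f g : ℕ → ℝ} {x : ℝ} (h : ∀ n, f n = g n) :
    HasSum f x ↔ HasSum g x := by
  rw [funext h]

theorem hasSum_two_div_three_pow : HasSum (fun n : ℕ => (2 : ℝ) / 3 ^ (n + 1)) 1 := by
  have h := (hasSum_geometric_of_lt_one (r := (1 / 3 : ℝ)) (by norm_num) (by norm_num)).mul_left
    (2 / 3 : ℝ)
  have e : (2 / 3 : ℝ) * (1 - 1 / 3)⁻¹ = 1 := by norm_num
  rw [e] at h
  refine (hasSum_iff_of_eq fun n => ?_).1 h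
  rw [pow_succ, one_div, inv_pow]
  field_simp

theorem tail_le_one {w : ℕ → ℤ} {t : ℝ} (hw : ∀ n, w n ≤ 2)
    (h : HasSum (fun n : ℕ => (w n : ℝ) / 3 ^ (n + 1)) t) :
    t ≤ 1 ∧ (t = 1 → ∀ n, w n = 2) := by
  have hle : ∀ n : ℕ, (w n : ℝ) / 3 ^ (n + 1) ≤ (2 : ℝ) / 3 ^ (n + 1) := fun n => by
    have : (w n : ℝ) ≤ 2 := by exact_mod_cast hw n
    gcongr
  refine ⟨hasSum_le hle h hasSum_two_div_three_pow, fun ht n => ?_⟩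
  by_contra hne
  have hlt : (w n : ℝ) < 2 := by exact_mod_cast lt_of_le_of_ne (hw n) hne
  have hlt' : (w n : ℝ) / 3 ^ (n + 1) < (2 : ℝ) / 3 ^ (n + 1) := by gcongr
  exact (hasSum_lt hle hlt' h hasSum_two_div_three_pow).ne ht

theorem tail_ge_neg_one {w : ℕ → ℤ} {t : ℝ} (hw : ∀ n, -2 ≤ w n)
    (h : HasSum (fun n : ℕ => (w n : ℝ) / 3 ^ (n + 1)) t) :
    -1 ≤ t ∧ (t = -1 → ∀ n, w n = -2) := by
  have h' : HasSum (fun n : ℕ => ((-w n : ℤ) : ℝ) / 3 ^ (n + 1)) (-t) := by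
    refine (hasSum_iff_of_eq fun n => ?_).1 h.neg
    push_cast
    ring
  obtain ⟨h1, h2⟩ := tail_le_one (w := fun n => -w n) (fun n => by have := hw n; omega) h'
  refine ⟨by linarith, fun ht n => ?_⟩
  have := h2 (by linarith) n
  omega

/-- The digit chosen for a remainder `t ∈ [-1, 1]`. -/
noncomputable def nextDigit (t : ℝ) : ℤ :=
  if 1 < 3 * t then 2 else if 3 * t < -1 then -2 else 0

/-- The successive remainders `t ↦ 3 t - nextDigit t`. -/
noncomputable def remainder (x : ℝ) : ℕ → ℝ
  | 0 => x
  | n + 1 => 3 * remainder x n - nextDigit (remainder x n)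

theorem nextDigit_cases (t : ℝ) :
    (nextDigit t = 2 ∧ 1 < 3 * t) ∨ (nextDigit t = -2 ∧ 3 * t < -1) ∨
      (nextDigit t = 0 ∧ -1 ≤ 3 * t ∧ 3 * t ≤ 1) := by
  unfold nextDigit
  split_ifs with h1 h2
  · exact Or.inl ⟨rfl, h1⟩
  · exact Or.inr (Or.inl ⟨rfl, h2⟩)
  · exact Or.inr (Or.inr ⟨rfl, not_lt.1 h2, not_lt.1 h1⟩)

theorem remainder_mem {x : ℝ} (hx : x ∈ Icc (0 : ℝ) 1) (n : ℕ) :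
    -1 ≤ remainder x n ∧ remainder x n ≤ 1 := by
  induction n with
  | zero => exact ⟨by have := hx.1; simp only [remainder]; linarith, hx.2⟩
  | succ n ih =>
    simp only [remainder]
    rcases nextDigit_cases (remainder x n) with ⟨h, h'⟩ | ⟨h, h'⟩ | ⟨h, h', h''⟩ <;> rw [h] <;>
      push_cast <;> constructor <;> linarith [ih.1, ih.2]

/-- A digit sequence built from the remainders. -/
noncomputable def greedyDigits (x : ℝ) : ℕ → ℤ
  | 0 => 0
  | n + 1 => nextDigit (remainder x n)

theorem greedyDigits_sum (x : ℝ) (n : ℕ) :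
    ∑ j ∈ Finset.range (n + 1), (greedyDigits x j : ℝ) / 3 ^ j = x - remainder x n / 3 ^ n := by
  induction n with
  | zero => simp [greedyDigits, remainder]
  | succ n ih =>
    rw [Finset.sum_range_succ, ih]
    simp only [greedyDigits, remainder]
    field_simp
    ring

theorem greedyDigits_digit (x : ℝ) (n : ℕ) :
    greedyDigits x n = 0 ∨ greedyDigits x n = 2 ∨ greedyDigits x n = -2 := by
  cases n with
  | zero => exact Or.inl rfl
  | succ n =>
    rcases nextDigit_cases (remainder x n) with ⟨h, _⟩ | ⟨h, _⟩ | ⟨h, _⟩ <;>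
      simp [greedyDigits, h]

theorem summable_digits {u : ℕ → ℤ} (hu : ∀ n, u n = 0 ∨ u n = 2 ∨ u n = -2) :
    Summable (fun n : ℕ => (u n : ℝ) / 3 ^ n) := by
  have hg : Summable (fun n : ℕ => (2 : ℝ) * (1 / 3) ^ n) :=
    (summable_geometric_of_lt_one (by norm_num) (by norm_num)).mul_left 2
  refine Summable.of_norm_bounded hg fun n => ?_
  have : |(u n : ℝ)| ≤ 2 := by rcases hu n with h | h | h <;> rw [h] <;> norm_num
  rw [Real.norm_eq_abs, abs_div, abs_of_pos (show (0 : ℝ) < 3 ^ n by positivity), one_div, inv_pow,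
    ← div_eq_mul_inv]
  gcongr

theorem greedyDigits_hasSum {x : ℝ} (hx : x ∈ Icc (0 : ℝ) 1) :
    HasSum (fun n : ℕ => (greedyDigits x n : ℝ) / 3 ^ n) x := by
  have hs := summable_digits (greedyDigits_digit x)
  have h0 : Filter.Tendsto (fun n : ℕ => remainder x n / 3 ^ n) Filter.atTop (𝓝 0) := by
    have hg : Filter.Tendsto (fun n : ℕ => ((1 / 3 : ℝ)) ^ n) Filter.atTop (𝓝 0) :=
      tendsto_pow_atTop_nhds_zero_of_lt_one (by norm_num) (by norm_num)
    refine squeeze_zero_norm (fun n => ?_) hg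
    rw [Real.norm_eq_abs, abs_div, abs_of_pos (show (0 : ℝ) < 3 ^ n by positivity), one_div,
      inv_pow, ← one_div]
    have := abs_le.2 (remainder_mem hx n)
    gcongr
  have h1 := (Filter.tendsto_add_atTop_iff_nat 1).2 hs.hasSum.tendsto_sum_nat
  have h2 : Filter.Tendsto (fun n : ℕ => x - remainder x n / 3 ^ n) Filter.atTop (𝓝 (x - 0)) :=
    tendsto_const_nhds.sub h0
  simp only [greedyDigits_sum] at h1
  have key := hs.hasSum
  rw [tendsto_nhds_unique h1 h2, sub_zero] at key
  exact key

theorem digits_hasSum_tail {u : ℕ → ℤ} {x : ℝ} (hu : MemTheta u)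
    (h : HasSum (fun n : ℕ => (u n : ℝ) / 3 ^ n) x) (n : ℕ) :
    (∀ j ≤ n, u j = greedyDigits x j) ∧
      HasSum (fun j : ℕ => (u (n + 1 + j) : ℝ) / 3 ^ (j + 1)) (remainder x n) := by
  have hle : ∀ n, u n ≤ 2 := fun n => by rcases hu.digit n with h | h | h <;> omega
  have hge : ∀ n, -2 ≤ u n := fun n => by rcases hu.digit n with h | h | h <;> omega
  induction n with
  | zero =>
    refine ⟨fun j hj => ?_, ?_⟩
    · obtain rfl : j = 0 := by omega
      exact hu.zero
    · have h' := (hasSum_nat_add_iff' 1).2 h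
      simp only [Finset.range_one, Finset.sum_singleton, hu.zero, Int.cast_zero, zero_div,
        sub_zero] at h'
      refine (hasSum_iff_of_eq fun j => ?_).1 h'
      rw [show 0 + 1 + j = j + 1 by ring]
  | succ n ih =>
    obtain ⟨ih1, ih2⟩ := ih
    have h3 : HasSum (fun j : ℕ => (u (n + 1 + 1 + j) : ℝ) / 3 ^ (j + 1))
        (3 * remainder x n - u (n + 1)) := by
      have h' := ((hasSum_nat_add_iff' 1).2 ih2).mul_left 3
      simp only [Finset.range_one, Finset.sum_singleton, add_zero, zero_add, pow_one] at h'
      rw [show 3 * (remainder x n - (u (n + 1) : ℝ) / 3) = 3 * remainder x n - u (n + 1) by ring]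
        at h'
      refine (hasSum_iff_of_eq fun j => ?_).1 h'
      rw [show n + 1 + 1 + j = n + 1 + (j + 1) by ring, pow_succ (3 : ℝ) (j + 1)]
      field_simp
    obtain ⟨a1, a2⟩ := tail_le_one (w := fun j => u (n + 1 + 1 + j)) (fun _ => hle _) h3
    obtain ⟨b1, b2⟩ := tail_ge_neg_one (w := fun j => u (n + 1 + 1 + j)) (fun _ => hge _) h3
    have key : u (n + 1) = nextDigit (remainder x n) := by
      have ha : u (n + 1) = -2 → 3 * remainder x n - u (n + 1) ≠ 1 := fun e e' =>
        hu.not_end_neg ⟨n + 1, e, fun j hj => by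
          have := a2 e' (j - (n + 1 + 1))
          rwa [show n + 1 + 1 + (j - (n + 1 + 1)) = j by omega] at this⟩
      have hb : u (n + 1) = 2 → 3 * remainder x n - u (n + 1) ≠ -1 := fun e e' =>
        hu.not_end_pos ⟨n + 1, e, fun j hj => by
          have := b2 e' (j - (n + 1 + 1))
          rwa [show n + 1 + 1 + (j - (n + 1 + 1)) = j by omega] at this⟩
      rcases hu.digit (n + 1) with e | e | e
      · rw [e] at a1 b1 ⊢
        push_cast at a1 b1
        rcases nextDigit_cases (remainder x n) with ⟨_, h'⟩ | ⟨_, h'⟩ | ⟨h', _⟩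
        · linarith
        · linarith
        · exact h'.symm
      · have hb := lt_of_le_of_ne b1 (Ne.symm (hb e))
        rw [e] at hb ⊢
        push_cast at hb
        rcases nextDigit_cases (remainder x n) with ⟨h', _⟩ | ⟨_, h'⟩ | ⟨_, h', h''⟩
        · exact h'.symm
        · linarith
        · linarith
      · have ha := lt_of_le_of_ne a1 (ha e)
        rw [e] at ha ⊢
        push_cast at ha
        rcases nextDigit_cases (remainder x n) with ⟨_, h'⟩ | ⟨h', _⟩ | ⟨_, h', h''⟩
        · linarith
        · exact h'.symm
        · linarith
    refine ⟨fun j hj => ?_, ?_⟩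
    · rcases Nat.lt_or_ge n j with hj' | hj'
      · obtain rfl : j = n + 1 := by omega
        exact key
      · exact ih1 j hj'
    · rw [key] at h3
      exact h3

theorem remainder_eq_of_tail {x : ℝ} {n : ℕ} {c : ℤ} (hx : x ∈ Icc (0 : ℝ) 1)
    (h : ∀ j > n, greedyDigits x j = c) :
    remainder x n = c / 2 := by
  have h' := (hasSum_nat_add_iff' (n + 1)).2 (greedyDigits_hasSum hx)
  rw [greedyDigits_sum] at h'
  have h2 : HasSum (fun j : ℕ => (greedyDigits x (j + (n + 1)) : ℝ) / 3 ^ (j + (n + 1)))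
      (c / 2 / 3 ^ n) := by
    have := hasSum_two_div_three_pow.mul_left ((c : ℝ) / 2 / 3 ^ n)
    rw [mul_one] at this
    refine (hasSum_iff_of_eq fun j => ?_).1 this
    rw [h _ (show j + (n + 1) > n by omega), pow_succ, pow_add, pow_succ]
    field_simp
  have := h'.unique h2
  field_simp at this
  linarith

theorem greedyDigits_memTheta {x : ℝ} (hx : x ∈ Icc (0 : ℝ) 1) : MemTheta (greedyDigits x) where
  zero := rfl
  digit := greedyDigits_digit x
  first_ne := by
    intro n hn
    cases n with
    | zero => simp [greedyDigits]
    | succ n =>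
      have hs := greedyDigits_sum x n
      rw [Finset.sum_eq_zero fun j hj => by rw [hn j (Finset.mem_range.1 hj)]; simp] at hs
      have hr : 0 ≤ remainder x n := by
        have h3 : (0 : ℝ) < 3 ^ n := by positivity
        have : remainder x n / 3 ^ n = x := by linarith
        rw [div_eq_iff h3.ne'] at this
        rw [this]
        exact mul_nonneg hx.1 h3.le
      simp only [greedyDigits]
      rcases nextDigit_cases (remainder x n) with ⟨h, _⟩ | ⟨_, h⟩ | ⟨h, _⟩
      · rw [h]; norm_num
      · linarith
      · rw [h]; norm_num
  not_end_pos := by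
    rintro ⟨n, hn, h⟩
    have hr := remainder_eq_of_tail hx h
    cases n with
    | zero => simp [greedyDigits] at hn
    | succ n =>
      simp only [greedyDigits] at hn
      simp only [remainder, hn] at hr
      rcases nextDigit_cases (remainder x n) with ⟨_, h'⟩ | ⟨h', _⟩ | ⟨h', _⟩
      · push_cast at hr; linarith
      · omega
      · omega
  not_end_neg := by
    rintro ⟨n, hn, h⟩
    have hr := remainder_eq_of_tail hx h
    cases n with
    | zero => simp [greedyDigits] at hn
    | succ n =>
      simp only [greedyDigits] at hn
      simp only [remainder, hn] at hr
      rcases nextDigit_cases (remainder x n) with ⟨h', _⟩ | ⟨_, h'⟩ | ⟨h', _⟩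
      · omega
      · push_cast at hr; linarith
      · omega

/-- Every `x ∈ [0, 1]` has exactly one intrinsic ternary expansion. -/
theorem existsUnique_isIntrinsicExpansion {x : ℝ} (hx : x ∈ Icc (0 : ℝ) 1) :
    ∃! u : ℕ → ℤ, IsIntrinsicExpansion u x :=
  ⟨greedyDigits x, ⟨greedyDigits_memTheta hx, greedyDigits_hasSum hx⟩, fun _ hu =>
    funext fun n => (digits_hasSum_tail hu.1 hu.2 n).1 n le_rfl⟩

end Expansion

open Classical in
/-- The digits `n ↦ u n` (`n ≥ 1`) of the intrinsic ternary expansion of `x ∈ [0, 1]`. -/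
noncomputable def intrinsicDigits (x : ℝ) : ℕ → ℤ :=
  if h : ∃ u : ℕ → ℤ, IsIntrinsicExpansion u x then h.choose else 0

theorem intrinsicDigits_spec {x : ℝ} (hx : x ∈ Icc (0 : ℝ) 1) :
    IsIntrinsicExpansion (intrinsicDigits x) x := by
  have h := (existsUnique_isIntrinsicExpansion hx).exists
  rw [intrinsicDigits, dif_pos h]
  exact h.choose_spec

/-! ### The class `𝓕` of iterated function systems -/

/-- A member `{φ_1, …, φ_k}` of the class `𝓕`, where `φ_i x = s_i 3^{-m_i} x + d_i`.
The index `⟨0, _⟩ : Fin k` plays the role of `1`. -/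
structure ClassF (k : ℕ) where
  /-- the signs `s_i = ±1` -/
  s : Fin k → ℤˣ
  /-- the exponents `m_i` -/
  m : Fin k → ℕ
  /-- the translation parts `d_i` -/
  d : Fin k → ℝ
  two_le : 2 ≤ k
  m_pos : ∀ i, 1 ≤ m i
  d_mem : ∀ i, d i ∈ Icc (0 : ℝ) 1
  s_first : s ⟨0, by omega⟩ = 1
  d_first : d ⟨0, by omega⟩ = 0
  exists_d_pos : ∃ i, 0 < d i
  d_pos_of_neg : ∀ i, s i = -1 → 0 < d i

namespace ClassF

variable {k : ℕ} (Φ : ClassF k)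

/-- The map `φ_i`. -/
noncomputable def map (i : Fin k) (x : ℝ) : ℝ :=
  (((Φ.s i : ℤˣ) : ℤ) : ℝ) * ((3 : ℝ) ^ Φ.m i)⁻¹ * x + Φ.d i

/-- `F` is a non-empty compact set with `F = ⋃ i, φ_i(F)`. -/
def IsAttractor (F : Set ℝ) : Prop :=
  F.Nonempty ∧ IsCompact F ∧ F = ⋃ i, Φ.map i '' F

theorem lipschitzWith_map (i : Fin k) : LipschitzWith (1 / 3) (Φ.map i) := by
  refine LipschitzWith.of_dist_le_mul fun x y => ?_
  have h3 : ((3 : ℝ) ^ Φ.m i)⁻¹ ≤ 1 / 3 := by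
    rw [← one_div]
    apply one_div_le_one_div_of_le (by norm_num)
    calc (3 : ℝ) = 3 ^ 1 := by norm_num
      _ ≤ 3 ^ Φ.m i := pow_le_pow_right₀ (by norm_num) (Φ.m_pos i)
  have hs : |(((Φ.s i : ℤˣ) : ℤ) : ℝ)| = 1 := by
    rcases Int.units_eq_one_or (Φ.s i) with h | h <;> simp [h]
  rw [Real.dist_eq, Real.dist_eq, map, map,
    show ∀ a b c x y : ℝ, a * b * x + c - (a * b * y + c) = a * (b * (x - y)) by intros; ring,
    abs_mul, hs, one_mul, abs_mul, abs_of_pos (by positivity)]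
  push_cast
  gcongr

theorem hausdorffEDist_image_le {K : NNReal} {f : ℝ → ℝ} (hK : K ≠ 0) (hf : LipschitzWith K f)
    (s t : Set ℝ) :
    Metric.hausdorffEDist (f '' s) (f '' t) ≤ K * Metric.hausdorffEDist s t := by
  have aux : ∀ (x : ℝ) (t : Set ℝ), Metric.infEDist (f x) (f '' t) ≤ K * Metric.infEDist x t := by
    intro x t
    have h0 : (K : ENNReal) ≠ 0 := ENNReal.coe_ne_zero.2 hK
    simp only [Metric.infEDist, iInf_image, ENNReal.mul_iInf_of_ne h0 ENNReal.coe_ne_top]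
    exact iInf₂_mono fun y _ => hf x y
  refine Metric.hausdorffEDist_le_of_infEDist ?_ ?_
  · rintro _ ⟨x, hx, rfl⟩
    exact (aux x t).trans (mul_le_mul_right (Metric.infEDist_le_hausdorffEDist_of_mem hx) _)
  · rintro _ ⟨x, hx, rfl⟩
    rw [Metric.hausdorffEDist_comm]
    exact (aux x s).trans (mul_le_mul_right (Metric.infEDist_le_hausdorffEDist_of_mem hx) _)

/-- The operator `K ↦ ⋃ i, φ_i(K)` on non-empty compact sets. -/
noncomputable def hutchinson (K : TopologicalSpace.NonemptyCompacts ℝ) :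
    TopologicalSpace.NonemptyCompacts ℝ where
  carrier := ⋃ i, Φ.map i '' (K : Set ℝ)
  isCompact' := isCompact_iUnion fun i => K.isCompact.image (Φ.lipschitzWith_map i).continuous
  nonempty' := by
    obtain ⟨x, hx⟩ := K.nonempty
    exact ⟨Φ.map ⟨0, by have := Φ.two_le; omega⟩ x, mem_iUnion.2 ⟨_, x, hx, rfl⟩⟩

theorem contractingWith_hutchinson : ContractingWith (1 / 3) Φ.hutchinson := by
  refine ⟨by rw [← NNReal.coe_lt_coe]; norm_num, fun K K' => ?_⟩
  change Metric.hausdorffEDist (⋃ i, Φ.map i '' (K : Set ℝ)) (⋃ i, Φ.map i '' (K' : Set ℝ)) ≤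
    _ * Metric.hausdorffEDist (K : Set ℝ) (K' : Set ℝ)
  exact Metric.hausdorffEDist_iUnion_le.trans
    (iSup_le fun i => hausdorffEDist_image_le (by norm_num) (Φ.lipschitzWith_map i) _ _)

/-- The attractor of an iterated function system in `𝓕` exists and is unique. -/
theorem existsUnique_isAttractor : ∃! F : Set ℝ, Φ.IsAttractor F := by
  have hc := Φ.contractingWith_hutchinson
  have : Nonempty (TopologicalSpace.NonemptyCompacts ℝ) := ⟨⟨⟨{0}, isCompact_singleton⟩, by simp⟩⟩
  refine ⟨SetLike.coe (ContractingWith.fixedPoint Φ.hutchinson hc), ⟨?_, ?_, ?_⟩, fun F hF => ?_⟩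
  · exact TopologicalSpace.NonemptyCompacts.nonempty _
  · exact TopologicalSpace.NonemptyCompacts.isCompact _
  · have := hc.fixedPoint_isFixedPt
    exact (congrArg (fun K : TopologicalSpace.NonemptyCompacts ℝ => (K : Set ℝ)) this).symm
  · have hfix : Function.IsFixedPt Φ.hutchinson ⟨⟨F, hF.2.1⟩, hF.1⟩ :=
      SetLike.coe_injective hF.2.2.symm
    exact congrArg (fun K : TopologicalSpace.NonemptyCompacts ℝ => (K : Set ℝ))
      (hc.fixedPoint_unique hfix)

/-- The attractor `F_Φ`: the unique non-empty compact set with `F = ⋃ i, φ_i(F)`. -/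
noncomputable def attractor : Set ℝ := Φ.existsUnique_isAttractor.choose

theorem attractor_spec : Φ.IsAttractor Φ.attractor :=
  Φ.existsUnique_isAttractor.choose_spec.1

/-! ### The translation matrix and the parameters -/

/-- The intrinsic translation matrix `U_Φ = (u_{i,n})`, with columns indexed by `n ≥ 1`
(column `0` is zero by convention). -/
noncomputable def U (i : Fin k) (n : ℕ) : ℤ := intrinsicDigits (Φ.d i) n

open Classical in
/-- `ℓ = gcd (m_i : d_i = 0)`. -/
noncomputable def ell : ℕ := (Finset.univ.filter fun i => Φ.d i = 0).gcd Φ.m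

/-- `r = gcd (m_1, …, m_k)`. -/
def r : ℕ := Finset.univ.gcd Φ.m

/-- `L = (min_i m_i / r - 1) (max_j m_j / r - 1)`. -/
noncomputable def L : ℕ := ((⨅ i, Φ.m i / Φ.r) - 1) * ((⨆ j, Φ.m j / Φ.r) - 1)

/-- `D = max_i m_i`. -/
noncomputable def D : ℕ := ⨆ i, Φ.m i

/-- `n_0`, the index of the first nonzero column of `U_Φ`. -/
noncomputable def n₀ : ℕ := sInf {n : ℕ | 1 ≤ n ∧ ∃ i, Φ.U i n ≠ 0}

/-! ### The matrices `V(x)` and the matching properties -/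

/-- The entry `v_{j,p}` of `V(x)` for a word `x = x_1 … x_n`: row `j` is `u_{x_j}`, shifted to the
right by the sum of the exponents of the preceding letters and multiplied by the product of their
signs.  Rows are indexed from `0`, columns from `1`. -/
noncomputable def V (x : List (Fin k)) (j : Fin x.length) (p : ℕ) : ℤ :=
  if ((x.take j).map Φ.m).sum < p then
    ((((x.take j).map Φ.s).prod : ℤˣ) : ℤ) * Φ.U (x.get j) (p - ((x.take j).map Φ.m).sum)
  else 0

/-- The `p`-th column of `V(x)` with all zero entries deleted. -/
noncomputable def reducedColumn (x : List (Fin k)) (p : ℕ) : List ℤ :=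
  (List.ofFn fun j => Φ.V x j p).filter (· ≠ 0)

/-- The matching properties (i)-(ii) for the column index `p` and the word `x`, where `a n` is the
`n`-th digit of `a`: the reduced column contains neither two consecutive letters `2` nor two
consecutive letters `-2`; and `a p = 0` if its first letter is `2`, `a p = 2` if it is `-2`. -/
def Matching (a : ℕ → ℤ) (p : ℕ) (x : List (Fin k)) : Prop :=
  (¬ [2, 2] <:+: Φ.reducedColumn x p ∧ ¬ [-2, -2] <:+: Φ.reducedColumn x p) ∧
    ((Φ.reducedColumn x p).head? = some 2 → a p = 0) ∧
    ((Φ.reducedColumn x p).head? = some (-2) → a p = 2)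

end ClassF

/-! ### Digit sequences -/

/-! The points `Φ.point x`, images of `0` under finite compositions, are dense in the attractor, and
the Cantor set is closed, so only the points `a + Φ.point x` matter. Their formal digits are the
digits of `a` plus the column sums of `V(x)`. If all partial sums down each column stay in `{0, 2}`,
these points lie in the Cantor set. The converse is the delicate half
(`staysInDigits_of_forall_mem_cantorSet`): appending a letter adds `± d_i / 3 ^ M`, and carries
might occur. They do not, because prefixing that letter with copies of the first map, a pure
contraction, gives Cantor points at distance `d_i / 3 ^ K` on the same side for arbitrarily large
`K`; this excludes the two tails forbidden in an intrinsic expansion (`sub_eq_shift_of_two_digits`),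
and uniqueness then makes the addition digitwise.

The columns are next read by a two-state automaton `Run`: at position `q` with digit `c`, the letter
`i` moves to position `q - m_i` and digit `c + u_{i,q}`, reflected if `s_i = -1`. Matching means
that the run never leaves `{0, 2}`.

It remains to reduce all runs to finitely many (`forall_run_iff`). From any `q ≥ n₀ + L`, Schur's
bound supplies a word leading to `n₀`, where a digit `2` in the column forces the current digit to
be `0`. Transitions are injective in the digit, so the admissible digit at `q` is unique. Hence
`reflectDigit (s_i) (a q + u_{i,q}) = a (q - m_i)` for large `q`. The maps with `d_i = 0` make `a`
periodic with period `ell`, and the equation passes this on to `U`. Conversely, periodicity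
propagates the equation from a finite window to all larger positions. -/

theorem hasSum_digits_shift {w : ℕ → ℤ} {x : ℝ} (h0 : w 0 = 0)
    (h : HasSum (fun n : ℕ => (w n : ℝ) / 3 ^ n) x) (K : ℕ) :
    HasSum (fun n : ℕ => (w (n - K) : ℝ) / 3 ^ n) (x / 3 ^ K) := by
  rw [← hasSum_nat_add_iff' K]
  rw [Finset.sum_eq_zero fun j hj => by
    rw [Nat.sub_eq_zero_of_le (Finset.mem_range.1 hj).le, h0]; simp, sub_zero]
  refine (hasSum_iff_of_eq fun j => ?_).1 (h.div_const (3 ^ K))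
  rw [Nat.add_sub_cancel, pow_add, div_div]

theorem hasSum_digits_tail {w : ℕ → ℤ} {x : ℝ}
    (h : HasSum (fun n : ℕ => (w n : ℝ) / 3 ^ n) x) {n : ℕ} (hz : ∀ j < n, w j = 0) :
    HasSum (fun j : ℕ => (w (j + (n + 1)) : ℝ) / 3 ^ (j + 1)) (3 ^ n * x - w n) := by
  have h' := ((hasSum_nat_add_iff' (n + 1)).2 h).mul_left ((3 : ℝ) ^ n)
  rw [Finset.sum_range_succ, Finset.sum_eq_zero fun j hj => by
    rw [hz j (Finset.mem_range.1 hj)]; simp, zero_add, mul_sub, mul_div_cancel₀ _ (by positivity)]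
    at h'
  refine (hasSum_iff_of_eq fun j => ?_).1 h'
  rw [show j + (n + 1) = n + (j + 1) by ring, pow_add]
  field_simp

/-- The digits after position `n` contribute at least `-1` in units of `3 ^ (-n)`, so they cannot
cancel more than half of a leading `2`. -/
theorem one_le_of_leading_two {w : ℕ → ℤ} {x : ℝ} (hw : ∀ n, -2 ≤ w n)
    (h : HasSum (fun n : ℕ => (w n : ℝ) / 3 ^ n) x) {n : ℕ} (hz : ∀ j < n, w j = 0)
    (hn : w n = 2) : 1 ≤ 3 ^ n * x := by
  have := (tail_ge_neg_one (w := fun j => w (j + (n + 1))) (fun _ => hw _)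
    (hasSum_digits_tail h hz)).1
  rw [hn] at this
  push_cast at this
  linarith

theorem le_neg_one_of_leading_neg_two {w : ℕ → ℤ} {x : ℝ} (hw : ∀ n, w n ≤ 2)
    (h : HasSum (fun n : ℕ => (w n : ℝ) / 3 ^ n) x) {n : ℕ} (hz : ∀ j < n, w j = 0)
    (hn : w n = -2) : 3 ^ n * x ≤ -1 := by
  have := (tail_le_one (w := fun j => w (j + (n + 1))) (fun _ => hw _)
    (hasSum_digits_tail h hz)).1
  rw [hn] at this
  push_cast at this
  linarith

theorem exists_leading {w : ℕ → ℤ} {n : ℕ} (h : w n ≠ 0) :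
    ∃ m ≤ n, w m ≠ 0 ∧ ∀ j < m, w j = 0 := by
  classical
  have hex : ∃ n, w n ≠ 0 := ⟨n, h⟩
  exact ⟨Nat.find hex, Nat.find_min' hex h, Nat.find_spec hex, fun j hj => by
    have := Nat.find_min hex hj
    simpa using this⟩

theorem MemTheta.shift {u : ℕ → ℤ} (hu : MemTheta u) (K : ℕ) : MemTheta fun n => u (n - K) where
  zero := by simp [hu.zero]
  digit n := hu.digit _
  first_ne n hn := by
    refine hu.first_ne _ fun j hj => ?_
    have := hn (j + K) (by omega)
    simpa using this
  not_end_pos := by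
    rintro ⟨n, hn, h⟩
    refine hu.not_end_pos ⟨n - K, hn, fun j hj => ?_⟩
    have := h (j + K) (by omega)
    simpa using this
  not_end_neg := by
    rintro ⟨n, hn, h⟩
    refine hu.not_end_neg ⟨n - K, hn, fun j hj => ?_⟩
    have := h (j + K) (by omega)
    simpa using this

/-- A leading `-2` would make the sum negative, so nonnegativity replaces the condition on the first
nonzero letter. -/
theorem MemTheta.of_hasSum_nonneg {e : ℕ → ℤ} {x : ℝ} (h0 : e 0 = 0)
    (hd : ∀ n, e n = 0 ∨ e n = 2 ∨ e n = -2)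
    (hp : ¬ ∃ n, e n = 2 ∧ ∀ j > n, e j = -2) (hn : ¬ ∃ n, e n = -2 ∧ ∀ j > n, e j = 2)
    (h : HasSum (fun n : ℕ => (e n : ℝ) / 3 ^ n) x) (hx : 0 ≤ x) : MemTheta e where
  zero := h0
  digit := hd
  first_ne n hz he := by
    have := le_neg_one_of_leading_neg_two (fun n => by rcases hd n with h | h | h <;> omega) h hz he
    have : 0 ≤ 3 ^ n * x := by positivity
    linarith
  not_end_pos := hp
  not_end_neg := hn

theorem eq_shift_of_hasSum {e u : ℕ → ℤ} {d : ℝ} {M : ℕ} (hu : IsIntrinsicExpansion u d)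
    (hd : d ∈ Icc (0 : ℝ) 1) (h0 : e 0 = 0) (he : ∀ n, e n = 0 ∨ e n = 2 ∨ e n = -2)
    (hp : ¬ ∃ n, e n = 2 ∧ ∀ j > n, e j = -2) (hn : ¬ ∃ n, e n = -2 ∧ ∀ j > n, e j = 2)
    (h : HasSum (fun n : ℕ => (e n : ℝ) / 3 ^ n) (d / 3 ^ M)) (n : ℕ) : e n = u (n - M) := by
  have hx : d / 3 ^ M ∈ Icc (0 : ℝ) 1 :=
    ⟨div_nonneg hd.1 (by positivity),
      div_le_one_of_le₀ (hd.2.trans (one_le_pow₀ (by norm_num))) (by positivity)⟩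
  exact congrFun ((existsUnique_isIntrinsicExpansion hx).unique
    ⟨.of_hasSum_nonneg h0 he hp hn h hx.1, h⟩
    ⟨hu.1.shift M, hasSum_digits_shift hu.1.zero hu.2 M⟩) n

/-- Adding this null series turns a tail `-2, 2, 2, …` starting at `n` into `0, -2, -2, …` without
changing the value. -/
theorem hasSum_two_neg_four (n : ℕ) :
    HasSum (fun j : ℕ => (((if j < n then 0 else if j = n then 2 else -4 : ℤ)) : ℝ) / 3 ^ j) 0 := by
  rw [← hasSum_nat_add_iff' (n + 1), Finset.sum_range_succ,
    Finset.sum_eq_zero fun j hj => by rw [if_pos (Finset.mem_range.1 hj)]; simp]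
  have := hasSum_two_div_three_pow.mul_left (-2 / (3 : ℝ) ^ n)
  simp only [lt_irrefl, if_true, if_false]
  convert! this using 1
  · funext j
    rw [if_neg (by omega), if_neg (by omega), show j + (n + 1) = n + (j + 1) by ring, pow_add]
    push_cast
    field_simp
    norm_num
  · push_cast
    ring

/-- If `b`, with two consecutive even digit values, can be increased within its class by
arbitrarily small `d / 3 ^ K`, then every increment `d / 3 ^ M` within the class is digitwise given
by the intrinsic expansion of `d`. -/
theorem sub_eq_shift_of_two_digits {b b' u : ℕ → ℤ} {t : ℤ} {β d : ℝ} {M : ℕ}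
    (hu : IsIntrinsicExpansion u d) (hd : d ∈ Icc (0 : ℝ) 1)
    (hb : ∀ n, b n = t ∨ b n = t + 2) (hβ : HasSum (fun n : ℕ => (b n : ℝ) / 3 ^ n) β)
    (hb' : ∀ n, b' n = t ∨ b' n = t + 2) (h0 : b' 0 = b 0)
    (hβ' : HasSum (fun n : ℕ => (b' n : ℝ) / 3 ^ n) (β + d / 3 ^ M))
    (hc : ∀ N : ℕ, ∃ K ≥ N, ∃ c : ℕ → ℤ, (∀ n, c n = t ∨ c n = t + 2) ∧ c 0 = b 0 ∧
      HasSum (fun n : ℕ => (c n : ℝ) / 3 ^ n) (β + d / 3 ^ K)) (p : ℕ) :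
    b' p - b p = u (p - M) := by
  have hsub : ∀ {c : ℕ → ℤ} {K : ℕ}, HasSum (fun n : ℕ => (c n : ℝ) / 3 ^ n) (β + d / 3 ^ K) →
      HasSum (fun n : ℕ => ((c n - b n : ℤ) : ℝ) / 3 ^ n) (d / 3 ^ K) := by
    intro c K h
    have := h.sub hβ
    rw [add_sub_cancel_left] at this
    refine (hasSum_iff_of_eq fun n => ?_).1 this
    push_cast
    ring
  have hdig : ∀ {c : ℕ → ℤ}, (∀ n, c n = t ∨ c n = t + 2) →
      ∀ n, c n - b n = 0 ∨ c n - b n = 2 ∨ c n - b n = -2 := by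
    intro c h n
    rcases h n with h | h <;> rcases hb n with h' | h' <;> omega
  have he := hdig hb'
  have hle : ∀ {c : ℕ → ℤ}, (∀ n, c n = t ∨ c n = t + 2) → ∀ n, c n - b n ≤ 2 := fun h n => by
    rcases hdig h n with h | h | h <;> omega
  have hge : ∀ {c : ℕ → ℤ}, (∀ n, c n = t ∨ c n = t + 2) → ∀ n, -2 ≤ c n - b n := fun h n => by
    rcases hdig h n with h | h | h <;> omega
  -- A first discrepancy at a position `n < K` would change the value by at least `3 ^ (-n)`, more
  -- than `d / 3 ^ K`.
  have hsmall : ∀ {c : ℕ → ℤ} {K n : ℕ}, (∀ n, c n = t ∨ c n = t + 2) →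
      HasSum (fun n : ℕ => (c n : ℝ) / 3 ^ n) (β + d / 3 ^ K) → n < K →
      (∀ j < n, c j - b j = 0) → c n - b n = 0 := by
    intro c K n hc h hn hz
    have hlt : (3 : ℝ) ^ n * (d / 3 ^ K) < 1 := by
      rw [← mul_div_assoc, div_lt_one (by positivity)]
      calc (3 : ℝ) ^ n * d ≤ 3 ^ n * 1 := by gcongr; exact hd.2
        _ < 3 ^ K := by rw [mul_one]; exact pow_lt_pow_right₀ (by norm_num) hn
    have hnn : 0 ≤ (3 : ℝ) ^ n * (d / 3 ^ K) := by
      have := hd.1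
      positivity
    rcases hdig hc n with h' | h' | h'
    · exact h'
    · exact absurd (one_le_of_leading_two (w := fun n => c n - b n) (hge hc) (hsub h) hz h')
        (not_le.2 hlt)
    · have := le_neg_one_of_leading_neg_two (w := fun n => c n - b n) (hle hc) (hsub h) hz h'
      linarith
  have hprefix : ∀ {c : ℕ → ℤ} {K : ℕ}, (∀ n, c n = t ∨ c n = t + 2) →
      HasSum (fun n : ℕ => (c n : ℝ) / 3 ^ n) (β + d / 3 ^ K) → ∀ n < K, c n - b n = 0 := by
    intro c K hc h n hn
    induction n using Nat.strong_induction_on with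
    | _ n ih => exact hsmall hc h hn fun j hj => ih j hj (hj.trans hn)
  rcases hd.1.eq_or_lt with rfl | hpos
  · have hz : ∀ n, b' n - b n = 0 := fun n =>
      hprefix (K := n + 1) hb' (by simpa using hβ') n (Nat.lt_succ_self n)
    refine eq_shift_of_hasSum (e := fun n => b' n - b n) hu hd (hz 0) he ?_ ?_ (hsub hβ') p
    · rintro ⟨n, hn, -⟩
      have := hz n
      omega
    · rintro ⟨n, hn, -⟩
      have := hz n
      omega
  refine eq_shift_of_hasSum (e := fun n => b' n - b n) hu hd (by simp [h0]) he ?_ ?_ (hsub hβ') p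
  -- A tail `2, -2, -2, …` forces `b` to be constantly `t + 2` after `n`. Then no sequence of the
  -- class sharing the digits of `b` up to `n` has a larger value, but `c` does.
  · rintro ⟨n, -, hj⟩
    obtain ⟨K, hK, c, hc, -, hs⟩ := hc (n + 1)
    have hne : ∃ m, c m - b m ≠ 0 := by
      by_contra! hz
      have h1 := hsub hs
      simp only [hz, Int.cast_zero, zero_div] at h1
      have h2 := h1.unique hasSum_zero
      have : 0 < d / 3 ^ K := by positivity
      linarith
    obtain ⟨m, hm⟩ := hne
    obtain ⟨m, -, hm, hz⟩ := exists_leading (w := fun m => c m - b m) hm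
    have hmn : n < m := by
      by_contra! hmn
      exact hm (hprefix hc hs m (by omega))
    have hbm : b m = t + 2 := by
      have := hj m hmn
      rcases hb m with h | h <;> rcases hb' m with h' | h' <;> omega
    have hm2 : c m - b m = -2 := by
      rcases hc m with h | h
      · omega
      · exact absurd (show c m - b m = 0 by omega) hm
    have := le_neg_one_of_leading_neg_two (w := fun n => c n - b n) (hle hc) (hsub hs) hz hm2
    have : 0 < 3 ^ m * (d / 3 ^ K) := by positivity
    linarith
  -- A tail `-2, 2, 2, …` forces `b` to be constantly `t` after `n`. Then `c - b` has no negative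
  -- digit, so neither has `u`; rewriting the tail as `0, -2, -2, …` yields another description of
  -- `u`, with negative digits.
  · rintro ⟨n, hn, hj⟩
    have hn0 : n ≠ 0 := by
      rintro rfl
      simp only [h0] at hn
      omega
    obtain ⟨K, hK, c, hc, hc0, hs⟩ := hc (n + 1)
    have hcnn : ∀ j, 0 ≤ c j - b j := by
      intro j
      rcases lt_or_ge j K with hjK | hjK
      · exact (hprefix hc hs j hjK).ge
      · have := hj j (by omega)
        rcases hb j with h | h <;> rcases hb' j with h' | h' <;> rcases hc j with h'' | h'' <;> omega
    have hcu := eq_shift_of_hasSum (e := fun n => c n - b n) hu hd (by simp [hc0]) (hdig hc)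
      (by
        rintro ⟨m, -, hm⟩
        have := hm (m + 1) (by omega)
        have := hcnn (m + 1)
        omega)
      (by
        rintro ⟨m, hm, -⟩
        have := hcnn m
        omega) (hsub hs)
    have hs2 := (hsub hβ').add (hasSum_two_neg_four n)
    rw [add_zero] at hs2
    have hlow : ∀ j > n, b' j - b j + (if j < n then 0 else if j = n then 2 else -4) = -2 := by
      intro j hjn
      rw [if_neg (by omega), if_neg (by omega)]
      have := hj j hjn
      omega
    have hu2 := eq_shift_of_hasSum (M := M)
      (e := fun j => b' j - b j + (if j < n then 0 else if j = n then 2 else -4)) hu hd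
      (by simp only [h0, if_pos (Nat.pos_of_ne_zero hn0)]; omega)
      (fun j => by
        rcases lt_trichotomy j n with h | rfl | h
        · simpa only [if_pos h, add_zero] using he j
        · left
          simp only [lt_irrefl, if_true, if_false]
          omega
        · exact Or.inr (Or.inr (hlow j h)))
      (by
        rintro ⟨m, hm, hm'⟩
        rcases lt_trichotomy m n with h | rfl | h
        · have := hm' n h
          simp only [lt_irrefl, if_true, if_false] at this
          omega
        · simp only [lt_irrefl, if_true, if_false] at hm
          omega
        · have := hlow m h
          omega)
      (by
        rintro ⟨m, -, hm⟩
        have := hm (m + n + 1) (by omega)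
        have := hlow (m + n + 1) (by omega)
        omega)
      ((hasSum_iff_of_eq fun j => by push_cast; ring).1 hs2) (n + 1 + M)
    have h1 := hcu (n + 1 + K)
    have h2 := hcnn (n + 1 + K)
    have h3 := hlow (n + 1 + M) (by omega)
    simp only [Nat.add_sub_cancel] at h1 hu2
    omega

/-! ### The Cantor set and its digits -/

/-- `b` is an expansion of `β` with digits `0` and `2` only (and `b 0 = 0`). -/
structure IsCantorExpansion (b : ℕ → ℤ) (β : ℝ) : Prop where
  zero : b 0 = 0
  digit : ∀ n, b n = 0 ∨ b n = 2
  hasSum : HasSum (fun n : ℕ => (b n : ℝ) / 3 ^ n) β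

theorem mem_cantorSet_iff {β : ℝ} : β ∈ cantorSet ↔ ∃ b, IsCantorExpansion b β := by
  rw [cantorSet_eq_zero_two_ofDigits]
  constructor
  · rintro ⟨f, hf, rfl⟩
    refine ⟨fun n => Nat.casesOn n 0 fun n => ((f n : ℕ) : ℤ), rfl, fun n => ?_, ?_⟩
    · cases n with
      | zero => exact Or.inl rfl
      | succ n =>
        have := hf n
        change ((f n : ℕ) : ℤ) = 0 ∨ ((f n : ℕ) : ℤ) = 2
        omega
    · rw [← hasSum_nat_add_iff' 1]
      rw [Finset.range_one, Finset.sum_singleton]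
      have h0 : Real.ofDigits f - ((0 : ℤ) : ℝ) / 3 ^ 0 = Real.ofDigits f := by simp
      refine h0.symm ▸ (hasSum_iff_of_eq fun n => ?_).1 (Real.summable_ofDigitsTerm (digits := f)).hasSum
      simp [Real.ofDigitsTerm, div_eq_mul_inv]
  · rintro ⟨b, hb⟩
    refine ⟨fun n => if b (n + 1) = 0 then 0 else 2, fun n => by dsimp only; split_ifs <;> decide, ?_⟩
    have h := (hasSum_nat_add_iff' 1).2 hb.hasSum
    simp only [Finset.range_one, Finset.sum_singleton, hb.zero, Int.cast_zero, zero_div,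
      sub_zero] at h
    refine HasSum.tsum_eq ((hasSum_iff_of_eq fun n => ?_).1 h)
    rcases hb.digit (n + 1) with h | h <;> simp [Real.ofDigitsTerm, h, div_eq_mul_inv]

theorem IsCantorExpansion.isIntrinsicExpansion {b : ℕ → ℤ} {β : ℝ} (h : IsCantorExpansion b β) :
    IsIntrinsicExpansion b β := by
  have hb := h.digit
  refine ⟨⟨h.zero, fun n => ?_, fun n _ => ?_, ?_, ?_⟩, h.hasSum⟩
  · rcases hb n with h | h <;> omega
  · rcases hb n with h | h <;> omega
  · rintro ⟨n, -, hn⟩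
    have := hn (n + 1) (by omega)
    rcases hb (n + 1) with h | h <;> omega
  · rintro ⟨n, hn, -⟩
    rcases hb n with h | h <;> omega

theorem isCantorExpansion_intrinsicDigits {a : ℝ} (ha : a ∈ cantorSet) :
    IsCantorExpansion (intrinsicDigits a) a := by
  have h01 := cantorSet_subset_unitInterval ha
  obtain ⟨b, hb⟩ := mem_cantorSet_iff.1 ha
  rwa [(existsUnique_isIntrinsicExpansion h01).unique (intrinsicDigits_spec h01)
    hb.isIntrinsicExpansion]

/-! ### Sums of words and periods -/

/-- Among the prefix sums of a word with at least `q` letters two agree modulo `q`; the block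
between them can be deleted. -/
theorem exists_short_word_modEq {ι : Type*} (m : ι → ℕ) {q : ℕ} (hq : 0 < q) (x : List ι) :
    ∃ y : List ι, y.length < q ∧ (y.map m).sum ≡ (x.map m).sum [MOD q] := by
  induction hn : x.length using Nat.strong_induction_on generalizing x with
  | _ n ih =>
    rcases lt_or_ge x.length q with h | h
    · exact ⟨x, h, rfl⟩
    obtain ⟨i, hi, j, hj, hne, hij⟩ := Finset.exists_ne_map_eq_of_card_lt_of_maps_to
      (s := Finset.range (q + 1)) (t := Finset.range q)
      (f := fun i => ((x.take i).map m).sum % q) (by simp)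
      (fun i _ => by simpa using Nat.mod_lt _ hq)
    wlog hlt : i < j generalizing i j
    · exact this j hj i hi hne.symm hij.symm (by omega)
    rw [Finset.mem_range] at hi hj
    obtain ⟨y, hy, hy'⟩ := ih (x.take i ++ x.drop j).length
      (by rw [List.length_append, List.length_take, List.length_drop]; omega) _ rfl
    refine ⟨y, hy, hy'.trans ?_⟩
    conv_rhs => rw [← List.take_append_drop j x]
    rw [List.map_append, List.map_append, List.sum_append, List.sum_append]
    exact Nat.ModEq.add_right _ hij

theorem exists_word_sum_eq_of_mem_closure {ι : Type*} (m : ι → ℕ) {n : ℕ}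
    (h : n ∈ AddSubmonoid.closure (Set.range m)) : ∃ x : List ι, (x.map m).sum = n := by
  induction h using AddSubmonoid.closure_induction with
  | mem _ h =>
    obtain ⟨i, rfl⟩ := h
    exact ⟨[i], by simp⟩
  | zero => exact ⟨[], rfl⟩
  | add _ _ _ _ hx hy =>
    obtain ⟨x, rfl⟩ := hx
    obtain ⟨y, rfl⟩ := hy
    exact ⟨x ++ y, by simp⟩

/-- **Schur's bound** for the Frobenius problem. -/
theorem exists_word_sum_eq {ι : Type*} [Fintype ι] (m : ι → ℕ) (hgcd : Finset.univ.gcd m = 1)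
    {i₀ : ι} {A : ℕ} (hpos : 0 < m i₀) (hA : ∀ i, m i ≤ A) {n : ℕ}
    (hn : (m i₀ - 1) * (A - 1) ≤ n) : ∃ x : List ι, (x.map m).sum = n := by
  have hs : Nat.setGcd (Set.range m) = 1 := by
    rw [← Nat.dvd_one, ← hgcd]
    exact Finset.dvd_gcd fun i _ => Nat.setGcd_dvd_of_mem ⟨i, rfl⟩
  -- As the gcd is `1`, all large numbers are sums; adding a multiple of `m i₀` to `n` gets there
  -- within the residue class of `n`.
  obtain ⟨n₁, h₁⟩ := Nat.exists_mem_closure_of_ge (Set.range m)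
  obtain ⟨x, hx⟩ := exists_word_sum_eq_of_mem_closure m
    (h₁ (n + m i₀ * n₁) (by nlinarith) (by rw [hs]; exact one_dvd _))
  obtain ⟨y, hy, hyx⟩ := exists_short_word_modEq m hpos x
  rw [hx] at hyx
  have hyn : (y.map m).sum ≡ n [MOD m i₀] := hyx.trans (by simp [Nat.ModEq])
  have hsum : (y.map m).sum ≤ y.length * A := by
    have := List.sum_le_card_nsmul (y.map m) A (by simpa using fun i _ => hA i)
    simpa using this
  rcases le_or_gt (y.map m).sum n with hle | hgt
  · obtain ⟨t, ht⟩ := (Nat.modEq_iff_dvd' hle).1 hyn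
    refine ⟨y ++ List.replicate t i₀, ?_⟩
    rw [List.map_append, List.sum_append, List.map_replicate, List.sum_replicate, smul_eq_mul,
      mul_comm t]
    omega
  -- Here the short sum exceeds `n` by at least `m i₀`, so `n ≤ (m i₀ - 1) * A - m i₀ = (m i₀ - 1) *
  -- (A - 1) - 1`, against the bound.
  · have hdvd := (Nat.modEq_iff_dvd' hgt.le).1 hyn.symm
    have hmle := Nat.le_of_dvd (by omega) hdvd
    have hA' : 0 < A := hpos.trans_le (hA i₀)
    obtain ⟨A, rfl⟩ : ∃ B, A = B + 1 := ⟨A - 1, by omega⟩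
    obtain ⟨μ, hμ⟩ : ∃ μ, m i₀ = μ + 1 := ⟨m i₀ - 1, by omega⟩
    rw [hμ] at hn hmle hy
    simp only [Nat.add_sub_cancel] at hn
    have : y.length * (A + 1) ≤ μ * (A + 1) := Nat.mul_le_mul_right _ (by omega)
    have h2 : μ * (A + 1) = μ * A + μ := by ring
    omega

theorem add_mul_eq_of_add_eq {α : Type*} {f : ℕ → α} {N p : ℕ} (hp : ∀ n ≥ N, f (n + p) = f n)
    (t : ℕ) : ∀ n ≥ N, f (n + p * t) = f n := by
  induction t with
  | zero => simp
  | succ t ih =>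
    intro n hn
    rw [mul_add, mul_one, ← add_assoc, hp _ (by omega), ih n hn]

/-- Euclid's algorithm on periods. Only forward shifts are used, so the threshold `N` does not grow.
-/
theorem add_gcd_eq_of_add_eq {α : Type*} {f : ℕ → α} {N : ℕ} (p q : ℕ)
    (hp : ∀ n ≥ N, f (n + p) = f n) (hq : ∀ n ≥ N, f (n + q) = f n) :
    ∀ n ≥ N, f (n + Nat.gcd p q) = f n := by
  induction p, q using Nat.gcd.induction with
  | H0 q => simpa using hq
  | H1 p q _ ih =>
    rw [Nat.gcd_rec]
    refine ih (fun n hn => ?_) hp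
    rw [← add_mul_eq_of_add_eq hp (q / p) _ (by omega), add_assoc, Nat.mod_add_div, hq n hn]

theorem add_finset_gcd_eq_of_add_eq {α ι : Type*} {f : ℕ → α} {N : ℕ} (s : Finset ι) (m : ι → ℕ)
    (h : ∀ i ∈ s, ∀ n ≥ N, f (n + m i) = f n) : ∀ n ≥ N, f (n + s.gcd m) = f n := by
  classical
  induction s using Finset.induction_on with
  | empty => simp
  | insert i s _ ih =>
    rw [Finset.gcd_insert]
    exact add_gcd_eq_of_add_eq _ _ (h i (Finset.mem_insert_self _ _))
      (ih fun j hj => h j (Finset.mem_insert_of_mem hj))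

/-! ### Alternating sequences -/

/-- Starting from `c` and adding the entries of the list one by one, all values are `0` or `2`. -/
def StaysInDigits : ℤ → List ℤ → Prop
  | _, [] => True
  | c, v :: l => (c + v = 0 ∨ c + v = 2) ∧ StaysInDigits (c + v) l

theorem staysInDigits_append {c v : ℤ} {l : List ℤ} :
    StaysInDigits c (l ++ [v]) ↔
      StaysInDigits c l ∧ (c + l.sum + v = 0 ∨ c + l.sum + v = 2) := by
  induction l generalizing c with
  | nil => simp [StaysInDigits]
  | cons w l ih => simp [StaysInDigits, ih, and_assoc, add_assoc]

theorem StaysInDigits.sum_mem {c : ℤ} {l : List ℤ} (hc : c = 0 ∨ c = 2) (h : StaysInDigits c l) :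
    c + l.sum = 0 ∨ c + l.sum = 2 := by
  induction l generalizing c with
  | nil => simpa using hc
  | cons v l ih =>
    rw [List.sum_cons, ← add_assoc]
    exact ih h.1 h.2

theorem pair_infix_cons_iff {v w : ℤ} {l : List ℤ} :
    [v, v] <:+: w :: l ↔ (w = v ∧ l.head? = some v) ∨ [v, v] <:+: l := by
  rw [List.infix_cons_iff, List.cons_prefix_cons]
  cases l with
  | nil => simp
  | cons a l => simp [eq_comm]

/-- From `0` the only admissible nonzero step is `2`, from `2` it is `-2`; so the nonzero entries
alternate and the first one is dictated by `c`. -/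
theorem filter_alternating_iff_staysInDigits {c : ℤ} {l : List ℤ} (hc : c = 0 ∨ c = 2)
    (hl : ∀ v ∈ l, v = 0 ∨ v = 2 ∨ v = -2) :
    ((¬ [2, 2] <:+: l.filter (· ≠ 0) ∧ ¬ [-2, -2] <:+: l.filter (· ≠ 0)) ∧
      ((l.filter (· ≠ 0)).head? = some 2 → c = 0) ∧
      ((l.filter (· ≠ 0)).head? = some (-2) → c = 2)) ↔ StaysInDigits c l := by
  induction l generalizing c with
  | nil => simp [StaysInDigits]
  | cons v l ih =>
    have ihl : ∀ {c : ℤ}, c = 0 ∨ c = 2 → _ := fun hc =>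
      ih (c := _) hc fun w hw => hl w (List.mem_cons_of_mem _ hw)
    have i0 := ihl (Or.inl rfl)
    have i2 := ihl (Or.inr rfl)
    clear ihl ih
    rcases hl v (List.mem_cons_self) with rfl | rfl | rfl
    · rcases hc with rfl | rfl <;> simp [StaysInDigits] at i0 i2 ⊢ <;> assumption
    · rw [List.filter_cons_of_pos (by simp)]
      simp only [pair_infix_cons_iff, StaysInDigits, List.head?_cons]
      rcases hc with rfl | rfl
      · rw [zero_add, ← i2]
        norm_num
        tauto
      · norm_num
    · rw [List.filter_cons_of_pos (by simp)]
      simp only [pair_infix_cons_iff, StaysInDigits, List.head?_cons]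
      rcases hc with rfl | rfl
      · norm_num
      · rw [show (2 : ℤ) + -2 = 0 by norm_num, ← i0]
        norm_num
        tauto

namespace ClassF

variable {k : ℕ} (Φ : ClassF k)

theorem U_spec (i : Fin k) : IsIntrinsicExpansion (Φ.U i) (Φ.d i) :=
  intrinsicDigits_spec (Φ.d_mem i)

theorem U_zero (i : Fin k) : Φ.U i 0 = 0 := (Φ.U_spec i).1.zero

/-! ### Columns of the matrices and the associated transducer -/

/-- The `p`-th column of `V(x)`, computed recursively. -/
noncomputable def column : List (Fin k) → ℕ → List ℤ
  | [], _ => []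
  | i :: x, p => Φ.U i p :: (column x (p - Φ.m i)).map (((Φ.s i : ℤˣ) : ℤ) * ·)

/-- The convention that column `0` vanishes lets truncated subtraction absorb the case distinction.
-/
theorem V_eq (x : List (Fin k)) (j : Fin x.length) (p : ℕ) :
    Φ.V x j p = ((((x.take j).map Φ.s).prod : ℤˣ) : ℤ) *
      Φ.U (x.get j) (p - ((x.take j).map Φ.m).sum) := by
  unfold V
  split_ifs with h
  · rfl
  · rw [Nat.sub_eq_zero_of_le (not_lt.1 h), U_zero, mul_zero]

theorem ofFn_V (x : List (Fin k)) (p : ℕ) : List.ofFn (fun j => Φ.V x j p) = Φ.column x p := by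
  induction x generalizing p with
  | nil => rfl
  | cons i x ih =>
    rw [column, ← ih, List.map_ofFn]
    simp only [V_eq]
    rw [show List.ofFn (n := (i :: x).length) _ = _ from List.ofFn_succ (n := x.length)]
    congr 1
    · simp
    · congr 1
      funext j
      simp [mul_assoc, Nat.sub_sub]

theorem column_digit (x : List (Fin k)) (p : ℕ) :
    ∀ v ∈ Φ.column x p, v = 0 ∨ v = 2 ∨ v = -2 := by
  induction x generalizing p with
  | nil => simp [column]
  | cons i x ih =>
    intro v hv
    rw [column, List.mem_cons, List.mem_map] at hv
    rcases hv with rfl | ⟨w, hw, rfl⟩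
    · exact (Φ.U_spec i).1.digit p
    · have := ih _ w hw
      rcases Int.units_eq_one_or (Φ.s i) with h | h <;> rw [h] <;> push_cast <;> omega

/-- The digit `v` itself if `σ = 1`, and `2 - v` if `σ = -1`. -/
def reflectDigit (σ : ℤˣ) (v : ℤ) : ℤ := (σ : ℤ) * (v - 1) + 1

theorem reflectDigit_mem {σ : ℤˣ} {v : ℤ} :
    (reflectDigit σ v = 0 ∨ reflectDigit σ v = 2) ↔ (v = 0 ∨ v = 2) := by
  unfold reflectDigit
  rcases Int.units_eq_one_or σ with rfl | rfl <;> push_cast <;> omega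

theorem reflectDigit_one (v : ℤ) : reflectDigit 1 v = v := by simp [reflectDigit]

theorem reflectDigit_injective (σ : ℤˣ) : Function.Injective (reflectDigit σ) := by
  intro v w h
  unfold reflectDigit at h
  rcases Int.units_eq_one_or σ with rfl | rfl <;> push_cast at h <;> omega

theorem reflectDigit_mul (σ τ : ℤˣ) (v : ℤ) :
    reflectDigit (σ * τ) v = reflectDigit σ (reflectDigit τ v) := by
  unfold reflectDigit
  push_cast
  ring

theorem reflectDigit_add (σ : ℤˣ) (v w : ℤ) :
    reflectDigit σ v + (σ : ℤ) * w = reflectDigit σ (v + w) := by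
  unfold reflectDigit
  ring

/-- Reading the word `x` from position `q` with the digit `c`, all digits met are `0` or `2`. -/
def Run : List (Fin k) → ℕ → ℤ → Prop
  | [], _, _ => True
  | i :: x, q, c => (c + Φ.U i q = 0 ∨ c + Φ.U i q = 2) ∧
      Run x (q - Φ.m i) (reflectDigit (Φ.s i) (c + Φ.U i q))

/-- The digit reached after reading the word `x` from position `q` with the digit `c`. -/
noncomputable def final : List (Fin k) → ℕ → ℤ → ℤ
  | [], _, c => c
  | i :: x, q, c => final x (q - Φ.m i) (reflectDigit (Φ.s i) (c + Φ.U i q))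

variable {Φ}

/-- Negating all later increments amounts to reflecting the digit set about `1`. The sign `σ`
accumulated so far must be general for the induction; the reflection made by `Run` cancels since
`s_i ^ 2 = 1`. -/
theorem staysInDigits_column_iff_run (σ : ℤˣ) (x : List (Fin k)) (q : ℕ) (c : ℤ) :
    StaysInDigits (reflectDigit σ c) ((Φ.column x q).map ((σ : ℤ) * ·)) ↔ Φ.Run x q c := by
  induction x generalizing σ q c with
  | nil => simp [column, StaysInDigits, Run]
  | cons i x ih =>
    rw [column, List.map_cons, StaysInDigits, Run, reflectDigit_add, reflectDigit_mem,
      ← ih (σ * Φ.s i), reflectDigit_mul,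
      ← reflectDigit_mul (Φ.s i) (Φ.s i), Int.units_mul_self, reflectDigit_one, List.map_map]
    simp [Function.comp_def, mul_assoc]

theorem matching_iff_run {a : ℕ → ℤ} {p : ℕ} (ha : a p = 0 ∨ a p = 2) (x : List (Fin k)) :
    Φ.Matching a p x ↔ Φ.Run x p (a p) := by
  have h := staysInDigits_column_iff_run (Φ := Φ) 1 x p (a p)
  rw [reflectDigit_one] at h
  simp only [Units.val_one, one_mul, List.map_id'] at h
  rw [← h, ← filter_alternating_iff_staysInDigits ha (Φ.column_digit x p), Matching,
    reducedColumn, ofFn_V]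

theorem run_append {x y : List (Fin k)} {q : ℕ} {c : ℤ} :
    Φ.Run (x ++ y) q c ↔ Φ.Run x q c ∧ Φ.Run y (q - (x.map Φ.m).sum) (Φ.final x q c) := by
  induction x generalizing q c with
  | nil => simp [Run, final]
  | cons i x ih => simp [Run, final, ih, and_assoc, Nat.sub_sub]

theorem Run.final_mem {x : List (Fin k)} {q : ℕ} {c : ℤ} (h : Φ.Run x q c) (hc : c = 0 ∨ c = 2) :
    Φ.final x q c = 0 ∨ Φ.final x q c = 2 := by
  induction x generalizing q c with
  | nil => exact hc
  | cons i x ih => exact ih h.2 (reflectDigit_mem.2 h.1)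

theorem final_injective (x : List (Fin k)) (q : ℕ) : Function.Injective (Φ.final x q) := by
  induction x generalizing q with
  | nil => exact fun _ _ h => h
  | cons i x ih => exact fun c c' h => add_right_cancel (reflectDigit_injective _ (ih _ h))

/-! ### Parameters -/

theorem U_eq_zero_of_lt {i : Fin k} {n : ℕ} (h : n < Φ.n₀) : Φ.U i n = 0 := by
  rcases Nat.eq_zero_or_pos n with rfl | hn
  · exact Φ.U_zero i
  · by_contra hne
    exact Nat.notMem_of_lt_sInf h ⟨hn, i, hne⟩

theorem n₀_spec : 1 ≤ Φ.n₀ ∧ ∃ i, Φ.U i Φ.n₀ ≠ 0 := by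
  refine Nat.sInf_mem (s := {n : ℕ | 1 ≤ n ∧ ∃ i, Φ.U i n ≠ 0}) ?_
  obtain ⟨i, hi⟩ := Φ.exists_d_pos
  by_contra! hempty
  have hz : ∀ n, Φ.U i n = 0 := by
    intro n
    rcases Nat.eq_zero_or_pos n with rfl | hn
    · exact Φ.U_zero i
    · by_contra hne
      have : n ∈ {n : ℕ | 1 ≤ n ∧ ∃ i, Φ.U i n ≠ 0} := ⟨hn, i, hne⟩
      simp [hempty] at this
  have h := (Φ.U_spec i).2
  simp only [hz, Int.cast_zero, zero_div] at h
  exact hi.ne (h.unique hasSum_zero).symm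

/-- A nonzero entry in column `n₀` is the first nonzero digit of its row, hence not `-2`. -/
theorem exists_U_n₀_eq_two : ∃ i, Φ.U i Φ.n₀ = 2 := by
  obtain ⟨i, hi⟩ := (n₀_spec (Φ := Φ)).2
  refine ⟨i, ?_⟩
  rcases (Φ.U_spec i).1.digit Φ.n₀ with h | h | h
  · exact absurd h hi
  · exact h
  · exact absurd h ((Φ.U_spec i).1.first_ne _ fun j hj => U_eq_zero_of_lt hj)

theorem m_le_D (i : Fin k) : Φ.m i ≤ Φ.D := le_ciSup (Set.finite_range Φ.m).bddAbove i

theorem U_eq_zero_of_d_eq_zero {i : Fin k} (h : Φ.d i = 0) (n : ℕ) : Φ.U i n = 0 := by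
  have h0 : IsIntrinsicExpansion (fun _ => 0) (Φ.d i) := by
    refine ⟨⟨rfl, fun _ => Or.inl rfl, fun _ _ => by norm_num, ?_, ?_⟩, ?_⟩
    · rintro ⟨_, h, _⟩
      norm_num at h
    · rintro ⟨_, h, _⟩
      norm_num at h
    · rw [h]
      simp [hasSum_zero]
  exact congrFun ((existsUnique_isIntrinsicExpansion (Φ.d_mem i)).unique (Φ.U_spec i) h0) n

theorem s_eq_one_of_d_eq_zero {i : Fin k} (h : Φ.d i = 0) : Φ.s i = 1 :=
  (Int.units_eq_one_or _).resolve_right fun hs => (Φ.d_pos_of_neg i hs).ne' h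

variable (Φ) in
/-- The index of the first map of the system. -/
def first : Fin k := ⟨0, by have := Φ.two_le; omega⟩

theorem ell_pos : 0 < Φ.ell := by
  classical
  refine Nat.pos_of_dvd_of_pos (Finset.gcd_dvd (f := Φ.m) (b := Φ.first) ?_)
    (Φ.m_pos Φ.first)
  exact Finset.mem_filter.2 ⟨Finset.mem_univ _, Φ.d_first⟩

theorem exists_word_to_n₀ (hr : Φ.r = 1) {q : ℕ} (hq : Φ.n₀ + Φ.L ≤ q) :
    ∃ x : List (Fin k), q - (x.map Φ.m).sum = Φ.n₀ ∧ x.length ≤ q - Φ.n₀ := by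
  have : Nonempty (Fin k) := ⟨Φ.first⟩
  obtain ⟨i₀, hi₀⟩ := exists_eq_ciInf_of_finite (f := Φ.m)
  have hL : Φ.L = (Φ.m i₀ - 1) * (Φ.D - 1) := by
    simp only [L, D, hr, Nat.div_one, hi₀]
  obtain ⟨x, hx⟩ := exists_word_sum_eq Φ.m hr (Φ.m_pos i₀) m_le_D (n := q - Φ.n₀) (by omega)
  refine ⟨x, by omega, ?_⟩
  have := List.card_nsmul_le_sum (x.map Φ.m) 1 (by simpa using fun i _ => Φ.m_pos i)
  simp only [List.length_map, smul_eq_mul, mul_one] at this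
  omega

/-! ### Runs and periodicity -/

theorem run_of_lt {x : List (Fin k)} {q : ℕ} {c : ℤ} (hq : q < Φ.n₀) (hc : c = 0 ∨ c = 2) :
    Φ.Run x q c := by
  induction x generalizing q c with
  | nil => trivial
  | cons i x ih =>
    rw [Run, U_eq_zero_of_lt hq, add_zero]
    exact ⟨hc, ih (by omega) (reflectDigit_mem.2 hc)⟩

/-- Each letter lowers the position by at least one, so after `n` letters it is below `n₀`, where
all columns vanish and nothing can fail. -/
theorem run_of_short {n : ℕ} {x : List (Fin k)} {q : ℕ} {c : ℤ} (hc : c = 0 ∨ c = 2)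
    (hq : q < Φ.n₀ + n) (h : ∀ y : List (Fin k), y.length ≤ n → Φ.Run y q c) : Φ.Run x q c := by
  induction x generalizing n q c with
  | nil => trivial
  | cons i x ih =>
    cases n with
    | zero => exact run_of_lt hq hc
    | succ n =>
      have h1 := (h [i] (by simp)).1
      have := Φ.m_pos i
      have := (n₀_spec (Φ := Φ)).1
      exact ⟨h1, ih (reflectDigit_mem.2 h1) (n := n) (by omega)
        fun y hy => (h (i :: y) (by simpa using hy)).2⟩

/-- The word goes to `n₀` and then reads a digit `2`, which is possible only from `0`; injectivity
of `final` pulls this back to `q`. -/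
theorem exists_word_determining (hr : Φ.r = 1) {q : ℕ} (hq : Φ.n₀ + Φ.L ≤ q) :
    ∃ x : List (Fin k), x.length ≤ q - Φ.n₀ + 1 ∧ ∀ c c' : ℤ, (c = 0 ∨ c = 2) →
      (c' = 0 ∨ c' = 2) → Φ.Run x q c → Φ.Run x q c' → c = c' := by
  obtain ⟨x, hx, hlen⟩ := exists_word_to_n₀ hr hq
  obtain ⟨j, hj⟩ := exists_U_n₀_eq_two (Φ := Φ)
  have key : ∀ c : ℤ, (c = 0 ∨ c = 2) → Φ.Run (x ++ [j]) q c → Φ.final x q c = 0 := by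
    intro c hc h
    rw [run_append, hx] at h
    have h1 := h.1.final_mem hc
    have h2 := h.2.1
    rw [hj] at h2
    omega
  refine ⟨x ++ [j], by simpa using hlen, fun c c' hc hc' h h' => final_injective (Φ := Φ) x q ?_⟩
  rw [key c hc h, key c' hc' h']

/-- Both sides are digits at position `q - m_i` from which the determining word can be read. -/
theorem reflectDigit_eq_of_run (hr : Φ.r = 1) {a : ℕ → ℤ} (ha : ∀ n, a n = 0 ∨ a n = 2) {q : ℕ}
    {i : Fin k} (hq : Φ.n₀ + Φ.L + Φ.m i ≤ q)
    (h : ∀ x : List (Fin k), x.length ≤ q - Φ.n₀ + 1 → Φ.Run x q (a q))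
    (h' : ∀ x : List (Fin k), x.length ≤ q - Φ.m i - Φ.n₀ + 1 →
      Φ.Run x (q - Φ.m i) (a (q - Φ.m i))) :
    reflectDigit (Φ.s i) (a q + Φ.U i q) = a (q - Φ.m i) := by
  obtain ⟨x, hlen, hx⟩ := exists_word_determining hr (q := q - Φ.m i) (by omega)
  have := Φ.m_pos i
  obtain ⟨h1, h2⟩ := h (i :: x) (by rw [List.length_cons]; omega)
  exact hx _ _ (reflectDigit_mem.2 h1) (ha _) h2 (h' x hlen)

theorem forall_run_iff (hr : Φ.r = 1) {a : ℕ → ℤ} (ha : ∀ n, a n = 0 ∨ a n = 2) :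
    (∀ q (x : List (Fin k)), Φ.Run x q (a q)) ↔
      (∀ n ≥ Φ.n₀ + Φ.L + Φ.D, ∀ i, Φ.U i (n + Φ.ell) = Φ.U i n) ∧
      (∀ n ≥ Φ.n₀ + Φ.L, a (n + Φ.ell) = a n) ∧
      (∀ (q : ℕ) (x : List (Fin k)), x ≠ [] →
        Φ.n₀ ≤ q → q < Φ.n₀ + Φ.L + Φ.D + 2 * Φ.ell * Φ.D → x.length ≤ q - Φ.n₀ + 1 →
        Φ.Run x q (a q)) := by
  constructor
  · intro h
    have hstep : ∀ (i : Fin k), ∀ q ≥ Φ.n₀ + Φ.L + Φ.m i,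
        reflectDigit (Φ.s i) (a q + Φ.U i q) = a (q - Φ.m i) := fun i q hq =>
      reflectDigit_eq_of_run hr ha hq (fun x _ => h q x) fun x _ => h _ x
    have hper : ∀ n ≥ Φ.n₀ + Φ.L, a (n + Φ.ell) = a n := by
      classical
      refine add_finset_gcd_eq_of_add_eq _ Φ.m fun i hi n hn => ?_
      have hd : Φ.d i = 0 := (Finset.mem_filter.1 hi).2
      have := hstep i (n + Φ.m i) (by omega)
      rwa [s_eq_one_of_d_eq_zero hd, U_eq_zero_of_d_eq_zero hd, reflectDigit_one, add_zero,
        Nat.add_sub_cancel] at this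
    refine ⟨fun n hn i => ?_, hper, fun q x _ _ _ _ => h q x⟩
    -- The summand `D` in the threshold keeps `n - m_i` in the range where `a` is already periodic.
    have := m_le_D (Φ := Φ) i
    have h1 := hstep i (n + Φ.ell) (by omega)
    rw [show n + Φ.ell - Φ.m i = n - Φ.m i + Φ.ell by omega, hper n (by omega),
      hper _ (by omega), ← hstep i n (by omega)] at h1
    exact add_left_cancel (reflectDigit_injective _ h1)
  · rintro ⟨hU, hper, hrun⟩
    have hshort : ∀ q, Φ.n₀ ≤ q → q < Φ.n₀ + Φ.L + Φ.D + 2 * Φ.ell * Φ.D →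
        ∀ x : List (Fin k), x.length ≤ q - Φ.n₀ + 1 → Φ.Run x q (a q) := by
      intro q h1 h2 x hx
      cases x with
      | nil => trivial
      | cons i x => exact hrun q _ (by simp) h1 h2 hx
    have hell := ell_pos (Φ := Φ)
    have hD : 0 < Φ.D := (Φ.m_pos Φ.first).trans (m_le_D _)
    -- The window thus contains a full period above `n₀ + L + D`, which is all that the induction
    -- below needs.
    have hbound : Φ.ell ≤ 2 * Φ.ell * Φ.D := by nlinarith
    have hstep : ∀ (i : Fin k) (q : ℕ), Φ.n₀ + Φ.L + Φ.D ≤ q →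
        reflectDigit (Φ.s i) (a q + Φ.U i q) = a (q - Φ.m i) := by
      intro i q
      have := m_le_D (Φ := Φ) i
      induction q using Nat.strong_induction_on with
      | _ q ih =>
        intro hq
        rcases lt_or_ge q (Φ.n₀ + Φ.L + Φ.D + Φ.ell) with hlt | hge
        · exact reflectDigit_eq_of_run hr ha (by omega) (hshort q (by omega) (by omega))
            (hshort _ (by omega) (by omega))
        · obtain ⟨q, rfl⟩ : ∃ q', q = q' + Φ.ell := ⟨q - Φ.ell, by omega⟩
          rw [hU q (by omega), hper q (by omega), ih q (by omega) (by omega),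
            show q + Φ.ell - Φ.m i = q - Φ.m i + Φ.ell by omega, hper _ (by omega)]
    intro q x
    induction x generalizing q with
    | nil => trivial
    | cons i x ih =>
      rcases lt_or_ge q (Φ.n₀ + Φ.L + Φ.D + 2 * Φ.ell * Φ.D) with hlt | hge
      · rcases lt_or_ge q Φ.n₀ with hq | hq
        · exact run_of_lt hq (ha q)
        · exact run_of_short (ha q) (n := q - Φ.n₀ + 1) (by omega) (hshort q hq hlt)
      -- Past the window, reading `i` leads to the digit of `a` at `q - m_i`, so the induction on
      -- the word applies again.
      · have h := hstep i q (by omega)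
        refine ⟨reflectDigit_mem.1 (h ▸ ha _), ?_⟩
        rw [h]
        exact ih _

/-! ### Points of the attractor -/

variable (Φ) in
/-- The image of `0` under the composition of maps given by a word. -/
noncomputable def point : List (Fin k) → ℝ
  | [] => 0
  | i :: x => Φ.map i (point x)

theorem map_mem_attractor {i : Fin k} {y : ℝ} (h : y ∈ Φ.attractor) :
    Φ.map i y ∈ Φ.attractor := by
  rw [Φ.attractor_spec.2.2]
  exact mem_iUnion.2 ⟨i, y, h, rfl⟩

/-- The first map is a contraction fixing `0`, so its iterates of any point of the closed attractor
tend to `0`. -/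
theorem zero_mem_attractor : (0 : ℝ) ∈ Φ.attractor := by
  obtain ⟨⟨y, hy⟩, hc, -⟩ := Φ.attractor_spec
  have hmap : ∀ z, Φ.map Φ.first z = z / 3 ^ Φ.m Φ.first := by
    intro z
    rw [map, show Φ.s Φ.first = 1 from Φ.s_first, show Φ.d Φ.first = 0 from Φ.d_first]
    simp [div_eq_inv_mul]
  have hiter : ∀ n, (Φ.map Φ.first)^[n] y ∈ Φ.attractor := by
    intro n
    induction n with
    | zero => exact hy
    | succ n ih =>
      rw [Function.iterate_succ_apply']
      exact map_mem_attractor ih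
  have heq : ∀ n, (Φ.map Φ.first)^[n] y = y * ((3 ^ Φ.m Φ.first)⁻¹) ^ n := by
    intro n
    induction n with
    | zero => simp
    | succ n ih => rw [Function.iterate_succ_apply', ih, hmap, pow_succ, div_eq_mul_inv, mul_assoc]
  refine hc.isClosed.mem_of_tendsto (f := fun n : ℕ => y * ((3 ^ Φ.m Φ.first)⁻¹) ^ n)
    (b := Filter.atTop) ?_ (Filter.Eventually.of_forall fun n => heq n ▸ hiter n)
  have : Filter.Tendsto (fun n : ℕ => (((3 : ℝ) ^ Φ.m Φ.first)⁻¹) ^ n) Filter.atTop (𝓝 0) :=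
    tendsto_pow_atTop_nhds_zero_of_lt_one (by positivity)
      (inv_lt_one_of_one_lt₀ (one_lt_pow₀ (by norm_num) (by have := Φ.m_pos Φ.first; omega)))
  simpa using this.const_mul y

theorem point_mem_attractor (x : List (Fin k)) : Φ.point x ∈ Φ.attractor := by
  induction x with
  | nil => exact zero_mem_attractor
  | cons i x ih => exact map_mem_attractor ih

theorem attractor_subset_closure_range_point : Φ.attractor ⊆ closure (range Φ.point) := by
  obtain ⟨B, hB⟩ := isBounded_iff_forall_norm_le.1 Φ.attractor_spec.2.1.isBounded
  have happrox : ∀ n : ℕ, ∀ y ∈ Φ.attractor, ∃ x, dist y (Φ.point x) ≤ (1 / 3) ^ n * B := by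
    intro n
    induction n with
    | zero => exact fun y hy => ⟨[], by simpa [point] using hB y hy⟩
    | succ n ih =>
      intro z hz
      rw [Φ.attractor_spec.2.2] at hz
      obtain ⟨i, y, hy, rfl⟩ := mem_iUnion.1 hz
      obtain ⟨x, hx⟩ := ih y hy
      refine ⟨i :: x, ((Φ.lipschitzWith_map i).dist_le_mul _ _).trans ?_⟩
      rw [pow_succ', mul_assoc]
      push_cast
      gcongr
  intro y hy
  rw [Metric.mem_closure_range_iff]
  intro ε hε
  have ht : Filter.Tendsto (fun n : ℕ => (1 / 3 : ℝ) ^ n * B) Filter.atTop (𝓝 (0 * B)) :=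
    (tendsto_pow_atTop_nhds_zero_of_lt_one (by norm_num) (by norm_num)).mul_const B
  rw [zero_mul] at ht
  obtain ⟨n, hn⟩ := (ht.eventually_lt_const hε).exists
  obtain ⟨x, hx⟩ := happrox n y hy
  exact ⟨x, hx.trans_lt hn⟩

theorem add_attractor_subset_iff {a : ℝ} {C : Set ℝ} (hC : IsClosed C) :
    (fun y => a + y) '' Φ.attractor ⊆ C ↔ ∀ x, a + Φ.point x ∈ C := by
  rw [image_subset_iff]
  refine ⟨fun h x => h (point_mem_attractor x), fun h => ?_⟩
  refine attractor_subset_closure_range_point.trans (closure_minimal ?_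
    (hC.preimage (continuous_const.add continuous_id)))
  rintro _ ⟨x, rfl⟩
  exact h x

/-! ### Ternary digits of the points and digitwise addition to `a` -/

theorem column_cons_sum (i : Fin k) (x : List (Fin k)) (p : ℕ) :
    (Φ.column (i :: x) p).sum =
      Φ.U i p + ((Φ.s i : ℤˣ) : ℤ) * (Φ.column x (p - Φ.m i)).sum := by
  rw [column, List.sum_cons, List.sum_map_mul_left, List.map_id']

theorem column_zero_sum (x : List (Fin k)) : (Φ.column x 0).sum = 0 := by
  induction x with
  | nil => rfl
  | cons i x ih => simp [column_cons_sum, ih, U_zero]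

theorem hasSum_column (x : List (Fin k)) :
    HasSum (fun p : ℕ => ((Φ.column x p).sum : ℝ) / 3 ^ p) (Φ.point x) := by
  induction x with
  | nil => simp [column, point, hasSum_zero]
  | cons i x ih =>
    have h := ((hasSum_digits_shift (column_zero_sum x) ih (Φ.m i)).mul_left
      (((Φ.s i : ℤˣ) : ℤ) : ℝ)).add (Φ.U_spec i).2
    rw [show (((Φ.s i : ℤˣ) : ℤ) : ℝ) * (Φ.point x / 3 ^ Φ.m i) + Φ.d i = Φ.point (i :: x) by
      rw [point, map]; ring] at h
    refine (hasSum_iff_of_eq fun p => ?_).1 h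
    rw [column_cons_sum]
    push_cast
    ring

theorem point_append (x y : List (Fin k)) :
    Φ.point (x ++ y) = Φ.point x +
      (((x.map Φ.s).prod : ℤˣ) : ℤ) * (Φ.point y / 3 ^ (x.map Φ.m).sum) := by
  induction x with
  | nil => simp [point]
  | cons i x ih =>
    rw [List.cons_append, point, point, ih, map, map, List.map_cons, List.map_cons,
      List.prod_cons, List.sum_cons, pow_add]
    push_cast
    field_simp
    ring

theorem column_append (x : List (Fin k)) (i : Fin k) (p : ℕ) :
    Φ.column (x ++ [i]) p = Φ.column x p ++
      [(((x.map Φ.s).prod : ℤˣ) : ℤ) * Φ.U i (p - (x.map Φ.m).sum)] := by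
  induction x generalizing p with
  | nil => simp [column]
  | cons j x ih => simp [column, ih, mul_assoc, Nat.sub_sub]

/-- Source of the arbitrarily small multiples of `d_i` that rule out carries. -/
theorem point_replicate_first_append (N : ℕ) (i : Fin k) :
    Φ.point (List.replicate N Φ.first ++ [i]) = Φ.d i / 3 ^ (N * Φ.m Φ.first) := by
  induction N with
  | zero => simp [point, map]
  | succ N ih =>
    rw [List.replicate_succ, List.cons_append, point, ih, map,
      show Φ.s Φ.first = 1 from Φ.s_first, show Φ.d Φ.first = 0 from Φ.d_first, Nat.add_mul,
      pow_add]
    push_cast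
    field_simp
    ring

theorem isCantorExpansion_add_point {a : ℝ} {b : ℕ → ℤ} (hb : IsCantorExpansion b a)
    {x : List (Fin k)} (h : ∀ p, StaysInDigits (b p) (Φ.column x p)) :
    IsCantorExpansion (fun p => b p + (Φ.column x p).sum) (a + Φ.point x) where
  zero := by simp [hb.zero, column_zero_sum]
  digit p := (h p).sum_mem (hb.digit p)
  hasSum := by
    refine (hasSum_iff_of_eq fun p => ?_).1 (hb.hasSum.add (hasSum_column x))
    push_cast
    ring

theorem staysInDigits_of_forall_mem_cantorSet {a : ℝ} {b : ℕ → ℤ} (hb : IsCantorExpansion b a)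
    (h : ∀ x, a + Φ.point x ∈ cantorSet) (x : List (Fin k)) (p : ℕ) :
    StaysInDigits (b p) (Φ.column x p) := by
  induction x using List.reverseRecOn generalizing p with
  | nil => trivial
  | append_singleton x i ih =>
    rw [column_append, staysInDigits_append]
    refine ⟨ih p, ?_⟩
    have hβ := isCantorExpansion_add_point hb ih
    obtain ⟨b', hb'⟩ := mem_cantorSet_iff.1 (h (x ++ [i]))
    have hpt : Φ.point [i] = Φ.d i := by simp [point, map]
    have hsmall : ∀ N : ℕ, ∃ K ≥ N, ∃ c, IsCantorExpansion c (a + Φ.point x +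
        (((x.map Φ.s).prod : ℤˣ) : ℤ) * (Φ.d i / 3 ^ K)) := by
      intro N
      obtain ⟨c, hc⟩ := mem_cantorSet_iff.1 (h (x ++ (List.replicate N Φ.first ++ [i])))
      refine ⟨N * Φ.m Φ.first + (x.map Φ.m).sum, ?_, c, ?_⟩
      · have := Nat.mul_le_mul_left N (Φ.m_pos Φ.first)
        omega
      · rwa [point_append, point_replicate_first_append, div_div, ← pow_add, ← add_assoc] at hc
    have hβ' := hb'.hasSum
    rw [point_append, hpt, ← add_assoc] at hβ'
    have key : b' p = b p + (Φ.column x p).sum +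
        (((x.map Φ.s).prod : ℤˣ) : ℤ) * Φ.U i (p - (x.map Φ.m).sum) := by
      rcases Int.units_eq_one_or (x.map Φ.s).prod with hs | hs
      · rw [hs] at hsmall hβ' ⊢
        simp only [Units.val_one, Int.cast_one, one_mul] at hsmall hβ' ⊢
        have := sub_eq_shift_of_two_digits (t := 0) (Φ.U_spec i) (Φ.d_mem i)
          (fun n => by simpa using hβ.digit n) hβ.hasSum (fun n => by simpa using hb'.digit n)
          (by rw [hb'.zero, hβ.zero]) hβ' (fun N => by
            obtain ⟨K, hK, c, hc⟩ := hsmall N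
            exact ⟨K, hK, c, fun n => by simpa using hc.digit n, by rw [hc.zero, hβ.zero],
              hc.hasSum⟩) p
        omega
      -- For the sign `-1` all sequences are negated: a decrease within digits `{0, 2}` becomes an
      -- increase within `{-2, 0}`.
      · rw [hs] at hsmall hβ' ⊢
        simp only [Units.val_neg, Units.val_one, Int.cast_neg, Int.cast_one, neg_mul, one_mul]
          at hsmall hβ' ⊢
        have hneg : ∀ {c : ℕ → ℤ} {γ : ℝ}, HasSum (fun n : ℕ => (c n : ℝ) / 3 ^ n) γ →
            HasSum (fun n : ℕ => ((-c n : ℤ) : ℝ) / 3 ^ n) (-γ) := fun h =>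
          (hasSum_iff_of_eq fun n => by push_cast; ring).1 h.neg
        have hdig : ∀ {v : ℤ}, v = 0 ∨ v = 2 → -v = -2 ∨ -v = -2 + 2 := by omega
        have := sub_eq_shift_of_two_digits (t := -2) (Φ.U_spec i) (Φ.d_mem i)
          (fun n => hdig (hβ.digit n)) (hneg hβ.hasSum)
          (b' := fun n => -b' n) (fun n => hdig (hb'.digit n))
          (by rw [hb'.zero, hβ.zero]) (by
            have := hneg hβ'
            rwa [neg_add, neg_neg] at this) (fun N => by
            obtain ⟨K, hK, c, hc⟩ := hsmall N
            refine ⟨K, hK, fun n => -c n, fun n => hdig (hc.digit n), by simp only [hc.zero, hβ.zero], ?_⟩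
            have := hneg hc.hasSum
            rwa [neg_add, neg_neg] at this) p
        omega
    rw [← key]
    exact hb'.digit p

theorem add_attractor_subset_cantorSet_iff {a : ℝ} (ha : a ∈ cantorSet) :
    (fun y => a + y) '' Φ.attractor ⊆ cantorSet ↔
      ∀ p (x : List (Fin k)), Φ.Run x p (intrinsicDigits a p) := by
  have hb := isCantorExpansion_intrinsicDigits ha
  have hrun : ∀ p (x : List (Fin k)), StaysInDigits (intrinsicDigits a p) (Φ.column x p) ↔
      Φ.Run x p (intrinsicDigits a p) := fun p x => by
    rw [← staysInDigits_column_iff_run 1, reflectDigit_one]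
    simp
  simp only [add_attractor_subset_iff isClosed_cantorSet, ← hrun]
  exact ⟨fun h p x => staysInDigits_of_forall_mem_cantorSet hb h x p, fun h x =>
    mem_cantorSet_iff.2 ⟨_, isCantorExpansion_add_point hb fun p => h p x⟩⟩

end ClassF

theorem mainTheorem5 {k : ℕ} (Φ : ClassF k) (a : ℝ) (ha : a ∈ cantorSet) (hr : Φ.r = 1) :
    (fun y => a + y) '' Φ.attractor ⊆ cantorSet ↔
      (∀ n ≥ Φ.n₀ + Φ.L + Φ.D, ∀ i, Φ.U i (n + Φ.ell) = Φ.U i n) ∧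
      (∀ n ≥ Φ.n₀ + Φ.L, intrinsicDigits a (n + Φ.ell) = intrinsicDigits a n) ∧
      (∀ (p : ℕ) (x : List (Fin k)), x ≠ [] →
        Φ.n₀ ≤ p → p < Φ.n₀ + Φ.L + Φ.D + 2 * Φ.ell * Φ.D → x.length ≤ p - Φ.n₀ + 1 →
        Φ.Matching (intrinsicDigits a) p x) := by
  have hdig := (isCantorExpansion_intrinsicDigits ha).digit
  rw [ClassF.add_attractor_subset_cantorSet_iff ha, ClassF.forall_run_iff hr hdig]
  simp only [ClassF.matching_iff_run (hdig _)]
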